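/- Let $X$ be a nonzero real Banach space with closed unit ball $B_X$ and unit sphere $S_X$. For $x^*\in S_{X^*}$ and $\varepsilon>0$ write $S(x^*,\varepsilon)=\{x\in B_X : x^*(x)>1-\varepsilon\}$. Suppose that $X$ has the local diameter 2 property+ (LD2P+), that is, for every $x^*\in S_{X^*}$, every $\varepsilon>0$, every $\delta>0$ and every $x\in S(x^*,\varepsilon)\cap S_X$ there exists $y\in S(x^*,\varepsilon)$ with $\|x-y\|>2-\delta$. Then the bidual $X^{**}$ is not smooth, that is, it is not the case that for every $x^{**}\in S_{X^{**}}$ there is exactly one $x^{***}\in S_{X^{***}}$ with $x^{***}(x^{**})=1$. -/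

import Mathlib

/-- The slice `S(f, ε) = {x ∈ B_X : f(x) > 1 - ε}` of the closed unit ball determined by the
functional `f` and `ε`; it is used for `‖f‖ = 1` and `ε > 0` only. -/
def ballSlice {X : Type*} [NormedAddCommGroup X] [NormedSpace ℝ X]
    (f : StrongDual ℝ X) (ε : ℝ) : Set X :=
  {x | x ∈ Metric.closedBall (0 : X) 1 ∧ 1 - ε < f x}

/-- The local diameter 2 property+: for every slice of the unit ball and every norm-one point `x`
of it, the slice contains points whose distance to `x` is as close to 2 as we want. -/
def HasLD2PPlus (X : Type*) [NormedAddCommGroup X] [NormedSpace ℝ X] : Prop :=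
  ∀ f ∈ Metric.sphere (0 : StrongDual ℝ X) 1, ∀ ε : ℝ, 0 < ε → ∀ δ : ℝ, 0 < δ →
    ∀ x ∈ ballSlice f ε ∩ Metric.sphere (0 : X) 1, ∃ y ∈ ballSlice f ε, 2 - δ < ‖x - y‖

/-- The norm of `X` is smooth: each norm-one vector has exactly one norm-one functional that takes
the value 1 at it. -/
def IsSmoothSpace (X : Type*) [NormedAddCommGroup X] [NormedSpace ℝ X] : Prop :=
  ∀ x ∈ Metric.sphere (0 : X) 1,
    ∃! f : StrongDual ℝ X, f ∈ Metric.sphere (0 : StrongDual ℝ X) 1 ∧ f x = 1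

/-!
Let `D` assign to each point of the unit sphere of `X` a supporting functional. If every point of
`S_X` is a smooth point of the bidual, weak* compactness makes `D` continuous from the norm to the
weak topology. A weakly continuous map from a complete metric space to a normed space has norm
oscillation less than any `ε > 0` near some point: its range on a separable closed subset is
norm separable, hence covered by countably many small balls, whose preimages are closed, and the
Baire category theorem applies. But the LD2P+ makes `D` oscillate by almost `2` near every point:
if `D x` is large at `y` and `‖x - y‖` is almost `2`, then a functional supporting `x - t • y` is
close to `-1` at `y`.
-/

open Filter Topology Set Metric TopologicalSpace NormedSpace

section WeakContinuity

theorem isClosed_preimage_of_continuous_toWeakSpace {E M : Type*} [AddCommGroup E] [Module ℝ E]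
    [TopologicalSpace E] [IsTopologicalAddGroup E] [ContinuousSMul ℝ E] [LocallyConvexSpace ℝ E]
    [TopologicalSpace M] {f : M → E} (hf : Continuous fun x => toWeakSpace ℝ E (f x)) {s : Set E}
    (hs : Convex ℝ s) (hsc : IsClosed s) : IsClosed (f ⁻¹' s) := by
  have hweak : IsClosed (toWeakSpace ℝ E '' s) := by
    rw [← hsc.closure_eq, hs.toWeakSpace_closure ℝ]
    exact isClosed_closure
  rw [← preimage_image_eq s (toWeakSpace ℝ E).injective]
  exact hweak.preimage hf

variable {E M : Type*} [NormedAddCommGroup E] [NormedSpace ℝ E] {f : M → E}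

theorem isSeparable_range_of_continuous_toWeakSpace [TopologicalSpace M] [SeparableSpace M]
    (hf : Continuous fun x => toWeakSpace ℝ E (f x)) : IsSeparable (range f) := by
  obtain ⟨Q, hQ, hQd⟩ := exists_countable_dense M
  let V := (Submodule.span ℝ (f '' Q)).topologicalClosure
  have hV : IsClosed (f ⁻¹' (V : Set E)) :=
    isClosed_preimage_of_continuous_toWeakSpace hf (Submodule.convex V)
      (Submodule.isClosed_topologicalClosure _)
  have hQV : Q ⊆ f ⁻¹' (V : Set E) := fun q hq =>
    Submodule.le_topologicalClosure _ (Submodule.subset_span (mem_image_of_mem f hq))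
  refine ((hQ.image f).isSeparable.span (R := ℝ)).closure.mono (range_subset_iff.2 fun x => ?_)
  exact closure_minimal hQV hV (hQd x)

theorem exists_isOpen_dist_lt_of_continuous_toWeakSpace [TopologicalSpace M] [BaireSpace M]
    [SeparableSpace M] [Nonempty M] (hf : Continuous fun x => toWeakSpace ℝ E (f x)) {ε : ℝ}
    (hε : 0 < ε) : ∃ U : Set M, IsOpen U ∧ U.Nonempty ∧ ∀ x ∈ U, ∀ y ∈ U, dist (f x) (f y) < ε := by
  obtain ⟨c, hc, hfc⟩ := isSeparable_range_of_continuous_toWeakSpace hf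
  have := hc.to_subtype
  have hclosed (q : c) : IsClosed (f ⁻¹' closedBall (q : E) (ε / 3)) :=
    isClosed_preimage_of_continuous_toWeakSpace hf (convex_closedBall _ _) isClosed_closedBall
  have hcover : ⋃ q : c, f ⁻¹' closedBall (q : E) (ε / 3) = univ := by
    refine eq_univ_of_forall fun x => ?_
    obtain ⟨q, hq, hxq⟩ := mem_closure_iff.1 (hfc (mem_range_self x)) (ε / 3) (by positivity)
    exact mem_iUnion.2 ⟨⟨q, hq⟩, hxq.le⟩
  obtain ⟨q, hq⟩ := nonempty_interior_of_iUnion_of_closed hclosed hcover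
  refine ⟨_, isOpen_interior, hq, fun x hx y hy => ?_⟩
  have hxq : x ∈ f ⁻¹' closedBall (q : E) (ε / 3) := interior_subset hx
  have hyq : y ∈ f ⁻¹' closedBall (q : E) (ε / 3) := interior_subset hy
  rw [mem_preimage, mem_closedBall] at hxq hyq
  linarith [dist_triangle_right (f x) (f y) q]

theorem exists_countable_mem_forall_mapsTo {ι α : Type*} [Countable ι] (T : ι → α → α) (x : α) :
    ∃ Q : Set α, Q.Countable ∧ x ∈ Q ∧ ∀ i, MapsTo (T i) Q Q := by
  refine ⟨range fun l : List ι => l.foldr T x, countable_range _, ⟨[], rfl⟩, fun i => ?_⟩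
  rintro _ ⟨l, rfl⟩
  exact ⟨i :: l, rfl⟩

theorem exists_eventually_dist_lt_of_continuous_toWeakSpace [PseudoMetricSpace M] [CompleteSpace M]
    [Nonempty M] (hf : Continuous fun x => toWeakSpace ℝ E (f x)) {ε : ℝ} (hε : 0 < ε) :
    ∃ x, ∀ᶠ y in 𝓝 x, dist (f y) (f x) < ε := by
  by_contra! hosc
  choose T hT hεT using fun x => exists_seq_forall_of_frequently (hosc x)
  -- On the closure of a countable set stable under all `T · n`, `f` still oscillates everywhere.
  obtain ⟨Q, hQ, hxQ, hTQ⟩ :=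
    exists_countable_mem_forall_mapsTo (fun n x => T x n) (Classical.arbitrary M)
  have : SeparableSpace (closure Q) := hQ.isSeparable.closure.separableSpace
  have : CompleteSpace (closure Q) := isClosed_closure.completeSpace_coe
  have : Nonempty (closure Q) := ⟨⟨_, subset_closure hxQ⟩⟩
  obtain ⟨U, hU, ⟨z, hz⟩, hfU⟩ := exists_isOpen_dist_lt_of_continuous_toWeakSpace
    (f := fun x : closure Q => f x) (hf.comp continuous_subtype_val) hε
  obtain ⟨V, hV, rfl⟩ := isOpen_induced_iff.1 hU
  obtain ⟨q, hqV, hqQ⟩ := _root_.mem_closure_iff.1 z.2 V hV hz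
  obtain ⟨n, hn⟩ := ((hT q).eventually_mem (hV.mem_nhds hqV)).exists
  exact (hεT q n).not_gt (hfU ⟨_, subset_closure (hTQ n hqQ)⟩ hn ⟨q, subset_closure hqQ⟩ hqV)

end WeakContinuity

section UniqueSupport

theorem norm_eq_one_of_apply_eq_one {𝕜 E : Type*} [NontriviallyNormedField 𝕜]
    [SeminormedAddCommGroup E] [NormedSpace 𝕜 E] {f : StrongDual 𝕜 E} (hf : ‖f‖ ≤ 1) {x : E}
    (hx : ‖x‖ ≤ 1) (hfx : f x = 1) : ‖f‖ = 1 := by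
  refine hf.antisymm ?_
  simpa only [hfx, norm_one] using f.unit_le_opNorm x hx

theorem tendsto_apply_of_unique_apply_eq {𝕜 E ι : Type*} [NontriviallyNormedField 𝕜]
    [ProperSpace 𝕜] [SeminormedAddCommGroup E] [NormedSpace 𝕜 E] {f : StrongDual 𝕜 E} {x : E}
    {r : ℝ} (hf : ∀ g : StrongDual 𝕜 E, ‖g‖ ≤ r → g x = f x → g = f) {F : ι → StrongDual 𝕜 E}
    {l : Filter ι} (hF : ∀ i, ‖F i‖ ≤ r) (hFx : Tendsto (fun i => F i x) l (𝓝 (f x))) (z : E) :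
    Tendsto (fun i => F i z) l (𝓝 (f z)) := by
  suffices Tendsto (fun i => StrongDual.toWeakDual (F i)) l (𝓝 (StrongDual.toWeakDual f)) from
    ((WeakDual.eval_continuous z).tendsto _).comp this
  refine (WeakDual.isCompact_closedBall (0 : StrongDual 𝕜 E) r).tendsto_nhds_of_unique_mapClusterPt
    (Eventually.of_forall fun i => mem_closedBall_zero_iff.2 (hF i)) fun g hg hgF => ?_
  have hgx : g x = f x := by
    have : MapClusterPt (g x) l fun i => F i x :=
      hgF.continuousAt_comp (WeakDual.eval_continuous x).continuousAt
    exact eq_of_nhds_neBot (this.neBot.mono (inf_le_inf_left _ hFx))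
  exact hf (WeakDual.toStrongDual g) (mem_closedBall_zero_iff.1 hg) hgx

end UniqueSupport

section VerySmooth

variable {X : Type*} [NormedAddCommGroup X] [NormedSpace ℝ X]

/-- The norm of `X` is smooth at `x`: exactly one norm-one functional takes the value 1 at `x`.
This is meant for `‖x‖ = 1`. -/
def IsSmoothAt (x : X) : Prop :=
  ∃! f : StrongDual ℝ X, f ∈ sphere (0 : StrongDual ℝ X) 1 ∧ f x = 1

theorem IsSmoothSpace.isSmoothAt (h : IsSmoothSpace X) {x : X} (hx : ‖x‖ = 1) : IsSmoothAt x :=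
  h x (mem_sphere_zero_iff_norm.2 hx)

theorem IsSmoothAt.tendsto_apply {ι : Type*} {x : X} (hx : IsSmoothAt x) (hx1 : ‖x‖ ≤ 1)
    {f : StrongDual ℝ X} (hf : ‖f‖ ≤ 1) (hfx : f x = 1) {F : ι → StrongDual ℝ X} {l : Filter ι}
    (hF : ∀ i, ‖F i‖ ≤ 1) (hFx : Tendsto (fun i => F i x) l (𝓝 1)) (z : X) :
    Tendsto (fun i => F i z) l (𝓝 (f z)) := by
  have hmem {g : StrongDual ℝ X} (hg : ‖g‖ ≤ 1) (hgx : g x = 1) :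
      g ∈ sphere (0 : StrongDual ℝ X) 1 ∧ g x = 1 :=
    ⟨mem_sphere_zero_iff_norm.2 (norm_eq_one_of_apply_eq_one hg hx1 hgx), hgx⟩
  exact tendsto_apply_of_unique_apply_eq
    (fun g hg hgx => hx.unique (hmem hg (hgx.trans hfx)) (hmem hf hfx)) hF (hfx ▸ hFx) z

theorem IsSmoothAt.tendsto_apply_of_predual {ι : Type*} {f : StrongDual ℝ X} (hf : IsSmoothAt f)
    (hf1 : ‖f‖ ≤ 1) {x : X} (hx : ‖x‖ ≤ 1) (hfx : f x = 1) {u : ι → X} {l : Filter ι}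
    (hu : ∀ i, ‖u i‖ ≤ 1) (hfu : Tendsto (fun i => f (u i)) l (𝓝 1)) (g : StrongDual ℝ X) :
    Tendsto (fun i => g (u i)) l (𝓝 (g x)) :=
  hf.tendsto_apply (f := inclusionInDoubleDual ℝ X x)
    (F := fun i => inclusionInDoubleDual ℝ X (u i)) hf1 ((double_dual_bound ℝ X x).trans hx) hfx
    (fun i => (double_dual_bound ℝ X (u i)).trans (hu i)) hfu g

/-- The norm of `X` is very smooth: the norm of the bidual is smooth at each norm-one vector
of `X`. -/
def IsVerySmoothSpace (X : Type*) [NormedAddCommGroup X] [NormedSpace ℝ X] : Prop :=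
  ∀ x ∈ sphere (0 : X) 1, IsSmoothAt (inclusionInDoubleDual ℝ X x)

theorem IsSmoothSpace.isVerySmoothSpace (h : IsSmoothSpace (StrongDual ℝ (StrongDual ℝ X))) :
    IsVerySmoothSpace X := fun x hx =>
  h.isSmoothAt <|
    ((inclusionInDoubleDualLi ℝ (E := X)).norm_map x).trans (mem_sphere_zero_iff_norm.1 hx)

/-- `D` is a support mapping: a selection, on the unit sphere, of norm-one functionals that attain
their norm at the given point. -/
def IsSupportMapping (D : sphere (0 : X) 1 → StrongDual ℝ X) : Prop :=
  ∀ x, ‖D x‖ = 1 ∧ D x x = 1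

theorem exists_isSupportMapping (X : Type*) [NormedAddCommGroup X] [NormedSpace ℝ X] :
    ∃ D : sphere (0 : X) 1 → StrongDual ℝ X, IsSupportMapping D := by
  have hsupport (x : sphere (0 : X) 1) : ∃ f : StrongDual ℝ X, ‖f‖ = 1 ∧ f x = 1 := by
    simpa using exists_dual_vector ℝ (x : X) (by simp)
  exact Classical.skolem.1 hsupport

theorem IsSupportMapping.tendsto_apply {D : sphere (0 : X) 1 → StrongDual ℝ X}
    (hD : IsSupportMapping D) (x : sphere (0 : X) 1) : Tendsto (fun y => D y x) (𝓝 x) (𝓝 1) := by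
  refine tendsto_iff_dist_tendsto_zero.2 <|
    squeeze_zero (fun _ => dist_nonneg) (fun y => ?_) (tendsto_iff_dist_tendsto_zero.1 tendsto_id)
  calc dist (D y x) 1 = ‖D y (x - y)‖ := by rw [map_sub, (hD y).2, Real.dist_eq, Real.norm_eq_abs]
    _ ≤ 1 * ‖(x - y : X)‖ := (D y).le_of_opNorm_le (hD y).1.le _
    _ = dist y x := by rw [one_mul, ← dist_eq_norm, dist_comm, Subtype.dist_eq]

theorem IsSupportMapping.continuous_toWeakSpace {D : sphere (0 : X) 1 → StrongDual ℝ X}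
    (hD : IsSupportMapping D) (hX : IsVerySmoothSpace X) :
    Continuous fun x => toWeakSpace ℝ (StrongDual ℝ X) (D x) := by
  refine WeakBilin.continuous_of_continuous_eval _ fun φ =>
    continuous_iff_continuousAt.2 fun x => ?_
  have hJx : ‖inclusionInDoubleDual ℝ X x‖ ≤ 1 :=
    (double_dual_bound ℝ X x).trans (norm_eq_of_mem_sphere x).le
  exact (hX x x.2).tendsto_apply_of_predual hJx (hD x).1.le (hD x).2 (fun y => (hD y).1.le)
    (hD.tendsto_apply x) φ

end VerySmooth

section LD2PPlus

variable {X : Type*} [NormedAddCommGroup X] [NormedSpace ℝ X]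

theorem norm_normalize_sub_le {x z : X} (hx : ‖x‖ = 1) : ‖normalize z - x‖ ≤ 2 * ‖z - x‖ := by
  rcases eq_or_ne z 0 with rfl | hz
  · simp [hx]
  have hnormalize : ‖normalize z - z‖ = ‖‖x‖ - ‖z‖‖ := by
    have : normalize z - z = (1 - ‖z‖) • normalize z := by
      rw [sub_smul, one_smul, norm_smul_normalize]
    rw [this, norm_smul, norm_normalize hz, mul_one, hx]
  have hnorm : ‖‖x‖ - ‖z‖‖ ≤ ‖z - x‖ := norm_sub_rev x z ▸ abs_norm_sub_norm_le x z
  linarith [norm_sub_le_norm_sub_add_norm_sub (normalize z) z x]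

theorem lt_norm_sub_smul {x y : X} (hy : ‖y‖ ≤ 1) {δ t : ℝ} (ht : t ≤ 1)
    (hxy : 2 - δ < ‖x - y‖) : 1 + t - δ < ‖x - t • y‖ := by
  have hsmul : ‖(1 - t) • y‖ ≤ 1 - t := by
    rw [norm_smul, Real.norm_of_nonneg (sub_nonneg.2 ht)]
    exact mul_le_of_le_one_right (sub_nonneg.2 ht) hy
  have hsub : x - y = x - t • y - (1 - t) • y := by module
  have := hsub ▸ norm_sub_le (x - t • y) ((1 - t) • y)
  linarith

theorem HasLD2PPlus.exists_forall_lt_norm_sub (hX : HasLD2PPlus X) {f : StrongDual ℝ X}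
    (hf : ‖f‖ = 1) {x : X} (hx : ‖x‖ = 1) (hfx : f x = 1) {ε t : ℝ} (hε : 0 < ε) (ht : 0 < t)
    (ht1 : t < 1) :
    ∃ x' : X, ‖x'‖ = 1 ∧ ‖x' - x‖ ≤ 2 * t ∧
      ∀ g : StrongDual ℝ X, ‖g‖ ≤ 1 → g x' = 1 → 2 - ε < ‖f - g‖ := by
  obtain ⟨y, ⟨hy, hfy⟩, hxy⟩ := hX f (mem_sphere_zero_iff_norm.2 hf) (ε / 2) (by positivity)
    (t * (ε / 2)) (by positivity) x
    ⟨⟨mem_closedBall_zero_iff.2 hx.le, by linarith⟩, mem_sphere_zero_iff_norm.2 hx⟩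
  rw [mem_closedBall_zero_iff] at hy
  set z := x - t • y with hz
  have hty : ‖t • y‖ ≤ t := by
    rw [norm_smul, Real.norm_of_nonneg ht.le]
    exact mul_le_of_le_one_right ht.le hy
  have hz0 : z ≠ 0 := sub_ne_zero.2 fun h => by linarith [h ▸ hx]
  have hzx : ‖z - x‖ ≤ t := by rwa [hz, sub_sub_cancel_left, norm_neg]
  refine ⟨normalize z, norm_normalize hz0, (norm_normalize_sub_le hx).trans (by linarith),
    fun g hg hgz => ?_⟩
  have hgnorm : g x - t * g y = ‖z‖ := by
    calc g x - t * g y = g (‖z‖ • normalize z) := by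
          rw [norm_smul_normalize, hz, map_sub, map_smul, smul_eq_mul]
      _ = ‖z‖ := by rw [map_smul, hgz, smul_eq_mul, mul_one]
  have hgx : g x ≤ 1 := (le_abs_self _).trans ((g.unit_le_opNorm x hx.le).trans hg)
  have hgy : g y < ε / 2 - 1 := by
    refine lt_of_mul_lt_mul_left ?_ ht.le
    linarith [lt_norm_sub_smul hy ht1.le hxy]
  calc 2 - ε < (f - g) y := by rw [sub_apply]; linarith
    _ ≤ ‖f - g‖ := (le_abs_self _).trans ((f - g).unit_le_opNorm y hy)

theorem HasLD2PPlus.frequently_lt_dist (hX : HasLD2PPlus X) {D : sphere (0 : X) 1 → StrongDual ℝ X}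
    (hD : IsSupportMapping D) (x : sphere (0 : X) 1) {ε : ℝ} (hε : 0 < ε) :
    ∃ᶠ y in 𝓝 x, 2 - ε < dist (D y) (D x) := by
  refine nhds_basis_ball.frequently_iff.2 fun r hr => ?_
  obtain ⟨t, ht, htr⟩ := exists_between (lt_min (half_pos hr) one_pos)
  obtain ⟨htr, ht1⟩ := lt_min_iff.1 htr
  obtain ⟨y, hy, hyx, hfar⟩ := hX.exists_forall_lt_norm_sub (hD x).1 (norm_eq_of_mem_sphere x)
    (hD x).2 hε ht ht1
  let y' : sphere (0 : X) 1 := ⟨y, mem_sphere_zero_iff_norm.2 hy⟩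
  refine ⟨y', ?_, ?_⟩
  · rw [mem_ball, Subtype.dist_eq, dist_eq_norm]
    exact hyx.trans_lt (by linarith)
  · rw [dist_comm, dist_eq_norm]
    exact hfar (D y') (hD y').1.le (hD y').2

end LD2PPlus

theorem corollary3p7_general (X : Type*) [NormedAddCommGroup X] [NormedSpace ℝ X] [CompleteSpace X]
    [Nontrivial X] (hX : HasLD2PPlus X) : ¬ IsVerySmoothSpace X := by
  intro hsmooth
  obtain ⟨D, hD⟩ := exists_isSupportMapping X
  have hDcont := hD.continuous_toWeakSpace hsmooth
  have : CompleteSpace (sphere (0 : X) 1) := isClosed_sphere.completeSpace_coe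
  have : Nonempty (sphere (0 : X) 1) := (NormedSpace.sphere_nonempty.2 zero_le_one).to_subtype
  obtain ⟨x, hx⟩ := exists_eventually_dist_lt_of_continuous_toWeakSpace hDcont one_pos
  obtain ⟨y, hfar, hnear⟩ := ((hX.frequently_lt_dist hD x one_pos).and_eventually hx).exists
  linarith

theorem corollary3p7 (X : Type*) [NormedAddCommGroup X] [NormedSpace ℝ X] [CompleteSpace X]
    [Nontrivial X] (hX : HasLD2PPlus X) :
    ¬ IsSmoothSpace (StrongDual ℝ (StrongDual ℝ X)) :=
  fun h => corollary3p7_general X hX h.isVerySmoothSpace
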